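/- Let $S\subset\mathbb{Z}^d$ be finite, and let $\mathcal M$ be the set of probability measures on $S$, viewed as a subset of $\mathbb{R}^S$. Let $Q$ be a Borel probability measure on $\mathcal M$ with support $\mathcal K$, and let $\hat{\mathcal K}\subset\mathbb{R}^S$ be the convex hull of $\mathcal K$. Assume that for some $\gamma>0$ and some $S'\subseteq S$ which generates $\mathbb{Z}^d$ as a monoid, $Q\{q: q(s)>\gamma\ \ \forall s\in S'\}=1$. Let $\omega=(\omega_x)_{x\in\mathbb{Z}^d}$ be i.i.d. with law $Q$, let $\eta$ be the law of $\omega$, and let $P_\omega$ be the transition matrix on $\mathbb{Z}^d$ with $p_\omega(x,x+s)=\omega_x(s)$ for $s\in S$ (and $0$ for all other transitions). For $p\in\hat{\mathcal K}$ let $P^h_p$ be the transition matrix of the homogeneous random walk with step law $p$, i.e. $p(x,x+s)=p(s)$. For a transition matrix $P$ with $n$-step transition probabilities $p^{(n)}(x,y)$ put $\rho(P)=\limsup_{n\to\infty}\big(p^{(n)}(x,x)\big)^{1/n}$, computed at a state $x$. Then for $\eta$-almost every $\omega$, for every state $x\in\mathbb{Z}^d$ at which the spectral radii are computed, $$\rho(P_\omega)=\sup_{p\in\hat{\mathcal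 K}}\rho(P^h_p)=\sup_{p\in\hat{\mathcal K}}\ \inf_{\theta\in\mathbb{R}^d}\ \sum_{s\in S}e^{\langle\theta,s\rangle}p(s),$$ and moreover $\rho(P_\omega)=1$ if and only if there is a $p\in\hat{\mathcal K}$ with $\sum_{s\in S}s\,p(s)=0$. -/

import Mathlib

open MeasureTheory Filter

namespace RWRE

noncomputable section

/-- `nStep P n x y` is the `n`-step transition probability `p⁽ⁿ⁾(x,y)` of the transition
matrix `P`, that is, the `(x,y)` entry of the `n`-th power of `P`. -/
def nStep {X : Type*} [DecidableEq X] (P : X → X → ℝ) : ℕ → X → X → ℝ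
  | 0 => fun x y => if x = y then 1 else 0
  | n + 1 => fun x y => ∑' z, P x z * nStep P n z y

/-- The spectral radius `ρ(P) = limsup (p⁽ⁿ⁾(x,x))^(1/n)` of the Markov chain with transition
matrix `P`, computed at the state `x` (for irreducible `P` it does not depend on `x`). -/
def spectralRadius {X : Type*} [DecidableEq X] (P : X → X → ℝ) (x : X) : ℝ :=
  limsup (fun n : ℕ => (nStep P n x x) ^ (1 / (n : ℝ))) atTop

/-- The set of all probability measures on the finite step set `S`, given by
their weights, with the topology and the Borel σ-algebra induced from `ℝ^S`. -/
abbrev StepLaw {d : ℕ} (S : Finset (Fin d → ℤ)) : Type :=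
  stdSimplex ℝ S

/-- The transition matrix `P_ω` on `ℤ^d`: `p_ω(x, x + s) = ω_x(s)` for `s ∈ S`, and all other
transitions have probability `0`. -/
def envKernel {d : ℕ} {S : Finset (Fin d → ℤ)} (ω : (Fin d → ℤ) → (S → ℝ))
    (x y : Fin d → ℤ) : ℝ :=
  if h : y - x ∈ S then ω x ⟨y - x, h⟩ else 0

/-- The transition matrix `P^h_p` of the homogeneous random walk with step law `p`. -/
def homKernel {d : ℕ} {S : Finset (Fin d → ℤ)} (p : S → ℝ) :
    (Fin d → ℤ) → (Fin d → ℤ) → ℝ :=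
  envKernel (fun _ => p)

/-- The law `η` of the i.i.d. environment with one-site marginal `Q`. -/
def envLaw {d : ℕ} {S : Finset (Fin d → ℤ)} (Q : Measure (StepLaw S)) [IsProbabilityMeasure Q] :
    Measure ((Fin d → ℤ) → StepLaw S) :=
  Measure.infinitePi (fun _ => Q)

/-- The convex hull, in `ℝ^S`, of the topological support of `Q`. -/
def hullSupport {d : ℕ} {S : Finset (Fin d → ℤ)} (Q : Measure (StepLaw S)) : Set (S → ℝ) :=
  convexHull ℝ (Subtype.val '' Q.support)

/-- The exponential moment `∑ₛ e^⟨θ,s⟩ p(s)`. -/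
def expMoment {d : ℕ} {S : Finset (Fin d → ℤ)} (p : S → ℝ) (θ : Fin d → ℝ) : ℝ :=
  ∑ s : S, Real.exp (∑ i, θ i * ((s : Fin d → ℤ) i : ℝ)) * p s

/-- The drift `∑ₛ s p(s) ∈ ℝ^d`. -/
def drift {d : ℕ} {S : Finset (Fin d → ℤ)} (p : S → ℝ) : Fin d → ℝ :=
  fun i => ∑ s : S, ((s : Fin d → ℤ) i : ℝ) * p s

end

end RWRE

/-!
The spectral radius is governed by a saddle point. For a law `p` on the steps let
`φ_p(θ) = ∑ₛ e^⟨θ,s⟩ p(s)` be its exponential moment, let `K` be the support of `Q`, and let `M` be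
the minimum over `θ` of `max_{q ∈ K} φ_q(θ)`. It is attained, at some `θ₀`, because ellipticity in
generating directions makes `φ_q` coercive (`exists_minimax`).

*Upper bound.* All `ω_x` lie in `K`, so `P_ω` maps `x ↦ e^⟨θ₀,x⟩` to at most `M` times itself, which
gives `p⁽ⁿ⁾(x,x) ≤ Mⁿ` (`spectralRadius_le`).

*Lower bound.* Since `θ₀` is a minimax point, for every direction `v` there is a `q ∈ K` with
`φ_q(θ₀) = M` and `⟨∇φ_q(θ₀), v⟩ ≥ 0` (`exists_grad_nonneg`). Choosing at each site `y` such a law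
for `v = -y` gives a pattern of laws which, tilted by `θ₀` and divided by `M`, has drift nowhere
pointing away from the origin (`IsTrap`). The squared norm is then a Lyapunov function, and a Chebyshev
estimate keeps the tilted walk within distance of order `√n` for `n` steps; elliptic steps bring it
back to the origin at a cost that is only exponential in `√n`. Almost surely the environment
contains copies of the pattern that are arbitrarily large and precise (`ae_exists_pattern`), and by
supermultiplicativity and irreducibility the spectral radius at any state dominates the return
probabilities at the centre of each copy (`nStep_le_spectralRadius_pow`). Hence
`ρ(P_ω) = M` (`IsTrap.spectralRadius_eq`).

*The variational formulas.* By Hahn-Banach, some law `p₀` in the convex hull of the maximizing laws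
has `∇φ_{p₀}(θ₀) = 0`, so `inf_θ φ_{p₀}(θ) = M`, and `M` is the maximum of `inf_θ φ_p(θ)` over the
hull (`exists_mem_convexHull_grad_eq_zero`). The argument above applied to the environment that is
constantly `p` gives `ρ(P^h_p) = inf_θ φ_p(θ)` (`spectralRadius_homKernel`). Finally, `M = 1` means
that `φ_{p₀}` is minimal at `θ = 0`, where its gradient is the drift of `p₀`.
-/

/-! ### Transition probabilities as finite sums -/

namespace RWRE

variable {d : ℕ} {S : Finset (Fin d → ℤ)}

theorem nStep_envKernel_zero (ω : (Fin d → ℤ) → (S → ℝ)) (x y : Fin d → ℤ) :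
    nStep (envKernel ω) 0 x y = if x = y then 1 else 0 := rfl

theorem nStep_envKernel_succ (ω : (Fin d → ℤ) → (S → ℝ)) (n : ℕ) (x y : Fin d → ℤ) :
    nStep (envKernel ω) (n + 1) x y = ∑ s : S, ω x s * nStep (envKernel ω) n (x + s) y := by
  change ∑' z, envKernel ω x z * nStep (envKernel ω) n z y = _
  rw [tsum_eq_sum (s := S.image (x + ·)) (fun z hz => ?_)]
  · rw [Finset.sum_image (by simp), ← Finset.sum_coe_sort]
    refine Finset.sum_congr rfl fun s _ => ?_
    simp [envKernel]
  · have : z - x ∉ S := fun h => hz (Finset.mem_image.2 ⟨z - x, h, by simp⟩)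
    simp [envKernel, this]

theorem nStep_envKernel_nonneg {ω : (Fin d → ℤ) → (S → ℝ)} (hω : ∀ x s, 0 ≤ ω x s) (n : ℕ)
    (x y : Fin d → ℤ) : 0 ≤ nStep (envKernel ω) n x y := by
  induction n generalizing x with
  | zero => rw [nStep_envKernel_zero]; positivity
  | succ n ih =>
    rw [nStep_envKernel_succ]
    exact Finset.sum_nonneg fun s _ => mul_nonneg (hω x s) (ih _)

theorem nStep_mul_nStep_le {ω : (Fin d → ℤ) → (S → ℝ)} (hω : ∀ x s, 0 ≤ ω x s) (m n : ℕ)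
    (x y z : Fin d → ℤ) :
    nStep (envKernel ω) m x y * nStep (envKernel ω) n y z ≤ nStep (envKernel ω) (m + n) x z := by
  induction m generalizing x with
  | zero =>
    rw [nStep_envKernel_zero, zero_add]
    split_ifs with h
    · simp [h]
    · simpa using nStep_envKernel_nonneg hω n x z
  | succ m ih =>
    rw [Nat.succ_add, nStep_envKernel_succ, nStep_envKernel_succ, Finset.sum_mul]
    refine Finset.sum_le_sum fun s _ => ?_
    rw [mul_assoc]
    exact mul_le_mul_of_nonneg_left (ih _) (hω x s)

theorem nStep_pow_le {ω : (Fin d → ℤ) → (S → ℝ)} (hω : ∀ x s, 0 ≤ ω x s) (n k : ℕ)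
    (x : Fin d → ℤ) :
    nStep (envKernel ω) n x x ^ k ≤ nStep (envKernel ω) (n * k) x x := by
  induction k with
  | zero => simp [nStep_envKernel_zero]
  | succ k ih =>
    rw [pow_succ, Nat.mul_succ]
    exact (mul_le_mul_of_nonneg_right ih (nStep_envKernel_nonneg hω _ _ _)).trans
      (nStep_mul_nStep_le hω _ _ _ _ _)

/-- A positive function `f` with `P_ω f ≤ M f` bounds the transition probabilities:
`p⁽ⁿ⁾(x,y) f(y) ≤ Mⁿ f(x)`. -/
theorem nStep_mul_le_of_superharmonic {ω : (Fin d → ℤ) → (S → ℝ)} (hω : ∀ x s, 0 ≤ ω x s)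
    {f : (Fin d → ℤ) → ℝ} (hf : ∀ x, 0 ≤ f x) {M : ℝ} (hM : 0 ≤ M)
    (h : ∀ x, ∑ s : S, ω x s * f (x + s) ≤ M * f x) (n : ℕ) (x y : Fin d → ℤ) :
    nStep (envKernel ω) n x y * f y ≤ M ^ n * f x := by
  induction n generalizing x with
  | zero =>
    rw [nStep_envKernel_zero]
    split_ifs with h
    · simp [h]
    · simpa using hf x
  | succ n ih =>
    rw [nStep_envKernel_succ, Finset.sum_mul]
    calc ∑ s : S, ω x s * nStep (envKernel ω) n (x + s) y * f y
        ≤ ∑ s : S, M ^ n * (ω x s * f (x + s)) := by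
          refine Finset.sum_le_sum fun s _ => ?_
          have := mul_le_mul_of_nonneg_left (ih (x + s)) (hω x s)
          linarith
      _ ≤ M ^ n * (M * f x) := by
          rw [← Finset.mul_sum]
          exact mul_le_mul_of_nonneg_left (h x) (pow_nonneg hM n)
      _ = M ^ (n + 1) * f x := by ring

/-- A Chebyshev bound for a weighted walk of constant total mass `M`: if a Lyapunov function `V`
grows on average by at most `C` per step and is at least `L` off the finite set `B`, then up to
the factor `Mⁿ` most of the mass is in `B` after `n` steps. -/
theorem le_sum_nStep_of_lyapunov {w : (Fin d → ℤ) → (S → ℝ)} (hw : ∀ x s, 0 ≤ w x s)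
    {M : ℝ} (hM : ∀ x, ∑ s : S, w x s = M) {V : (Fin d → ℤ) → ℝ} (hV : ∀ x, 0 ≤ V x)
    {C L : ℝ} (hL : 0 < L) (h : ∀ x, ∑ s : S, w x s * V (x + s) ≤ M * (V x + C))
    {B : Finset (Fin d → ℤ)} (hB : ∀ y, y ∉ B → L ≤ V y) (n : ℕ) (x : Fin d → ℤ) :
    M ^ n * (1 - (V x + C * n) / L) ≤ ∑ y ∈ B, nStep (envKernel w) n x y := by
  have hM0 : 0 ≤ M := by rw [← hM 0]; exact Finset.sum_nonneg fun s _ => hw 0 s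
  induction n generalizing x with
  | zero =>
    simp only [nStep_envKernel_zero, Finset.sum_ite_eq]
    split_ifs with hx
    · have := div_nonneg (hV x) hL.le
      simp; linarith
    · have := (one_le_div hL).2 (hB x hx)
      simp; linarith
  | succ n ih =>
    simp only [nStep_envKernel_succ]
    rw [Finset.sum_comm]
    calc M ^ (n + 1) * (1 - (V x + C * (n + 1 : ℕ)) / L)
        = M ^ n * (M * (1 - C * n / L) - (M * (V x + C)) / L) := by push_cast; ring
      _ ≤ M ^ n * (M * (1 - C * n / L) - (∑ s : S, w x s * V (x + s)) / L) := by
          gcongr; exact h x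
      _ = ∑ s : S, w x s * (M ^ n * (1 - (V (x + s) + C * n) / L)) := by
          rw [← hM x, Finset.sum_mul, Finset.sum_div, ← Finset.sum_sub_distrib, Finset.mul_sum]
          refine Finset.sum_congr rfl fun s _ => ?_
          ring
      _ ≤ _ := by
          refine Finset.sum_le_sum fun s _ => ?_
          rw [← Finset.mul_sum]
          exact mul_le_mul_of_nonneg_left (ih _) (hw x s)

theorem nStep_envKernel_shift (ω : (Fin d → ℤ) → (S → ℝ)) (z : Fin d → ℤ) (n : ℕ)
    (x y : Fin d → ℤ) :
    nStep (envKernel fun v => ω (z + v)) n x y = nStep (envKernel ω) n (z + x) (z + y) := by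
  induction n generalizing x with
  | zero => simp [nStep_envKernel_zero]
  | succ n ih =>
    simp only [nStep_envKernel_succ, ih, add_assoc]

/-- Exponential tilting (Doob transform) of the transition probabilities. -/
theorem nStep_tilt (π : (Fin d → ℤ) → (S → ℝ)) (f : (Fin d → ℤ) → ℝ)
    (hf : ∀ x y, f (x + y) = f x * f y) (n : ℕ) (x y : Fin d → ℤ) :
    f x * nStep (envKernel fun v (s : S) => f s * π v s) n x y
      = f y * nStep (envKernel π) n x y := by
  induction n generalizing x with
  | zero =>
    simp only [nStep_envKernel_zero]
    split_ifs with h <;> simp [h]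
  | succ n ih =>
    simp only [nStep_envKernel_succ, Finset.mul_sum]
    refine Finset.sum_congr rfl fun s _ => ?_
    have := ih (x + s)
    rw [hf] at this
    linear_combination π x s * this

/-- If the environment `ω` dominates `c π` on the ball of radius `N` for the size function `g`,
then the `n`-step probabilities from points that cannot leave that ball in `n` steps compare. -/
theorem pow_mul_nStep_le {ω π : (Fin d → ℤ) → (S → ℝ)} (hπ : ∀ x s, 0 ≤ π x s)
    {c : ℝ} (hc : 0 ≤ c) {g : (Fin d → ℤ) → ℕ} {R : ℕ} (hg : ∀ x (s : S), g (x + s) ≤ g x + R)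
    {N : ℕ} (h : ∀ y, g y ≤ N → ∀ s, c * π y s ≤ ω y s) (n : ℕ) (x y : Fin d → ℤ)
    (hx : g x + R * n ≤ N) :
    c ^ n * nStep (envKernel π) n x y ≤ nStep (envKernel ω) n x y := by
  induction n generalizing x with
  | zero => simp [nStep_envKernel_zero]
  | succ n ih =>
    simp only [nStep_envKernel_succ, Finset.mul_sum]
    refine Finset.sum_le_sum fun s _ => ?_
    have h1 := h x (by omega) s
    have h2 := ih (x + s) (by have := hg x s; rw [Nat.mul_succ] at hx; omega)
    have h3 : 0 ≤ c ^ n * nStep (envKernel π) n (x + s) y :=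
      mul_nonneg (pow_nonneg hc n) (nStep_envKernel_nonneg hπ _ _ _)
    have h4 : 0 ≤ c * π x s := mul_nonneg hc (hπ x s)
    calc c ^ (n + 1) * (π x s * nStep (envKernel π) n (x + s) y)
        = (c * π x s) * (c ^ n * nStep (envKernel π) n (x + s) y) := by ring
      _ ≤ _ := mul_le_mul h1 h2 h3 (h4.trans h1)

/-! ### Paths of the elliptic steps -/

/-- A point that is a sum of `m` steps of `S'` is reached in `m` steps with probability at least
`γᵐ`, if all these steps have probability at least `γ` everywhere. -/
theorem pow_le_nStep_of_sum {ω : (Fin d → ℤ) → (S → ℝ)} (hω : ∀ x s, 0 ≤ ω x s)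
    {S' : Set S} {γ : ℝ} (hγ : 0 ≤ γ) (h : ∀ x, ∀ s ∈ S', γ ≤ ω x s)
    (l : List (Fin d → ℤ)) (hl : ∀ v ∈ l, v ∈ Subtype.val '' S') (x : Fin d → ℤ) :
    γ ^ l.length ≤ nStep (envKernel ω) l.length x (x + l.sum) := by
  induction l generalizing x with
  | nil => simp [nStep_envKernel_zero]
  | cons v l ih =>
    obtain ⟨s, hs, rfl⟩ := hl v (by simp)
    rw [List.length_cons, nStep_envKernel_succ, List.sum_cons, ← add_assoc]
    have h1 := ih (fun v hv => hl v (by simp [hv])) (x + s)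
    calc γ ^ (l.length + 1) = γ * γ ^ l.length := by ring
      _ ≤ ω x s * nStep (envKernel ω) l.length (x + s) (x + s + l.sum) :=
          mul_le_mul (h x s hs) h1 (pow_nonneg hγ _) (hω x s)
      _ ≤ _ := Finset.single_le_sum
          (f := fun t : S => ω x t * nStep (envKernel ω) l.length (x + t) (x + s + l.sum))
          (fun t _ => mul_nonneg (hω x t) (nStep_envKernel_nonneg hω _ _ _)) (Finset.mem_univ s)

/-- If `G` generates `ℤᵈ` as a monoid, then every `v` is a sum of at most `ℓ ‖v‖₁` elements of
`G`, for some constant `ℓ`. -/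
theorem exists_length_le_of_closure_eq_top {G : Set (Fin d → ℤ)}
    (hG : AddSubmonoid.closure G = ⊤) :
    ∃ ℓ : ℕ, ∀ v : Fin d → ℤ, ∃ l : List (Fin d → ℤ),
      (∀ u ∈ l, u ∈ G) ∧ l.sum = v ∧ l.length ≤ ℓ * ∑ i, (v i).natAbs := by
  have key : ∀ v : Fin d → ℤ, ∃ l : List (Fin d → ℤ), (∀ u ∈ l, u ∈ G) ∧ l.sum = v := fun v =>
    AddSubmonoid.exists_list_of_mem_closure (hG ▸ AddSubmonoid.mem_top v)
  choose l hl hsum using key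
  refine ⟨∑ i, ((l (Pi.single i 1)).length + (l (Pi.single i (-1))).length), fun v => ?_⟩
  set ℓ := ∑ i, ((l (Pi.single i 1)).length + (l (Pi.single i (-1))).length) with hℓ
  have hle : ∀ i, (l (Pi.single i 1)).length + (l (Pi.single i (-1))).length ≤ ℓ := fun i =>
    Finset.single_le_sum
      (f := fun i => (l (Pi.single i 1)).length + (l (Pi.single i (-1))).length)
      (fun _ _ => Nat.zero_le _) (Finset.mem_univ i)
  obtain ⟨k, hk⟩ : ∃ k, ∑ i, (v i).natAbs = k := ⟨_, rfl⟩
  induction k generalizing v with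
  | zero =>
    refine ⟨[], by simp, ?_, by simp⟩
    ext i
    have := (Finset.sum_eq_zero_iff.1 hk) i (Finset.mem_univ i)
    simp at this
    simp [this]
  | succ k ih =>
    obtain ⟨i, hi⟩ : ∃ i, v i ≠ 0 := by
      by_contra! hcon
      simp [hcon] at hk
    -- a coordinate step towards the origin lowers the `ℓ¹` size by one
    have step : ∀ e : ℤ, (v i - e).natAbs + 1 = (v i).natAbs →
        (l (Pi.single i e)).length ≤ ℓ →
        ∃ l : List (Fin d → ℤ), (∀ u ∈ l, u ∈ G) ∧ l.sum = v ∧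
          l.length ≤ ℓ * ∑ i, (v i).natAbs := by
      intro e he hlen
      have h1 : ∑ j, ((v - Pi.single i e : Fin d → ℤ) j).natAbs = k := by
        rw [Fintype.sum_eq_add_sum_compl i] at hk ⊢
        have : ∑ j ∈ {i}ᶜ, ((v - Pi.single i e : Fin d → ℤ) j).natAbs
            = ∑ j ∈ {i}ᶜ, (v j).natAbs := by
          refine Finset.sum_congr rfl fun j hj => ?_
          have : j ≠ i := by simpa using hj
          simp [this]
        rw [this]
        simp only [Pi.sub_apply, Pi.single_eq_same]
        omega
      obtain ⟨l', h2, h3, h4⟩ := ih _ h1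
      refine ⟨l (Pi.single i e) ++ l', ?_, ?_, ?_⟩
      · intro u hu
        rcases List.mem_append.1 hu with hu | hu
        exacts [hl _ u hu, h2 u hu]
      · rw [List.sum_append, hsum, h3]; abel
      · rw [List.length_append, hk]
        rw [h1] at h4
        rw [Nat.mul_succ]; omega
    rcases lt_or_gt_of_ne hi with h | h
    · exact step (-1) (by omega) (le_trans (Nat.le_add_left _ _) (hle i))
    · exact step 1 (by omega) (le_trans (Nat.le_add_right _ _) (hle i))

end RWRE

/-! ### The convex hull of a compact set -/

namespace RWRE

/-- In finite dimension, by Carathéodory's theorem, the convex hull of a compact set is a finite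
union of continuous images of compact sets. -/
theorem isCompact_convexHull_of_isCompact {E : Type*} [NormedAddCommGroup E] [NormedSpace ℝ E]
    [FiniteDimensional ℝ E] {s : Set E} (hs : IsCompact s) : IsCompact (convexHull ℝ s) := by
  have heq : convexHull ℝ s = ⋃ k ∈ Finset.range (Module.finrank ℝ E + 2),
      (fun a : (Fin k → ℝ) × (Fin k → E) => ∑ i, a.1 i • a.2 i) ''
        (stdSimplex ℝ (Fin k) ×ˢ Set.univ.pi fun _ => s) := by
    ext x
    simp only [Set.mem_iUnion, Set.mem_image, Set.mem_prod, Prod.exists, exists_prop]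
    constructor
    · intro hx
      obtain ⟨ι, _, z, w, hz, hind, hw, hw1, rfl⟩ := eq_pos_convex_span_of_mem_convexHull hx
      have e := Fintype.equivFin ι
      refine ⟨Fintype.card ι, ?_, w ∘ e.symm, z ∘ e.symm, ⟨⟨fun i => (hw _).le, ?_⟩, ?_⟩, ?_⟩
      · have h1 := hind.card_le_finrank_succ
        have h2 := Submodule.finrank_le (vectorSpan ℝ (Set.range z))
        simp only [Finset.mem_range]
        omega
      · simpa using (e.symm.sum_comp w).trans hw1
      · exact fun i _ => hz ⟨_, rfl⟩
      · exact e.symm.sum_comp fun i => w i • z i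
    · rintro ⟨k, -, w, z, ⟨⟨hw, hw1⟩, hz⟩, rfl⟩
      exact (convex_convexHull ℝ s).sum_mem (fun i _ => hw i) hw1
        fun i _ => subset_convexHull ℝ s (hz i trivial)
  rw [heq]
  refine (Finset.range _).isCompact_biUnion fun k _ => ?_
  exact ((isCompact_stdSimplex ℝ (Fin k)).prod (isCompact_univ_pi fun _ => hs)).image
    (by fun_prop)

/-! ### Exponential moments -/

variable {d : ℕ} {S : Finset (Fin d → ℤ)}

/-- The pairing `⟨θ, x⟩` of `θ ∈ ℝᵈ` with a lattice point `x`. -/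
def pairing (θ : Fin d → ℝ) (x : Fin d → ℤ) : ℝ := ∑ i, θ i * (x i : ℝ)

/-- The gradient `∑ₛ s e^⟨θ,s⟩ p(s)` of the exponential moment of `p` at `θ`, that is, the drift
of the step weights tilted by `θ`. -/
noncomputable def expMomentGrad (p : S → ℝ) (θ : Fin d → ℝ) : Fin d → ℝ :=
  fun i => ∑ s : S, ((s : Fin d → ℤ) i : ℝ) * (Real.exp (pairing θ s) * p s)

theorem pairing_add_right (θ : Fin d → ℝ) (x y : Fin d → ℤ) :
    pairing θ (x + y) = pairing θ x + pairing θ y := by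
  simp [pairing, mul_add, Finset.sum_add_distrib]

theorem pairing_add_left (θ θ' : Fin d → ℝ) (x : Fin d → ℤ) :
    pairing (θ + θ') x = pairing θ x + pairing θ' x := by
  simp [pairing, add_mul, Finset.sum_add_distrib]

theorem pairing_smul (c : ℝ) (θ : Fin d → ℝ) (x : Fin d → ℤ) :
    pairing (c • θ) x = c * pairing θ x := by
  simp [pairing, Finset.mul_sum, mul_assoc]

theorem pairing_zero (x : Fin d → ℤ) : pairing 0 x = 0 := by simp [pairing]

theorem expMoment_eq (p : S → ℝ) (θ : Fin d → ℝ) :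
    expMoment p θ = ∑ s : S, Real.exp (pairing θ s) * p s := rfl

theorem expMoment_zero {p : S → ℝ} (hp : ∑ s, p s = 1) : expMoment p 0 = 1 := by
  simpa [expMoment_eq, pairing_zero] using hp

theorem expMoment_nonneg {p : S → ℝ} (hp : ∀ s, 0 ≤ p s) (θ : Fin d → ℝ) :
    0 ≤ expMoment p θ :=
  Finset.sum_nonneg fun s _ => mul_nonneg (Real.exp_pos _).le (hp s)

theorem expMoment_pos {p : S → ℝ} (hp : ∀ s, 0 ≤ p s) (hp1 : ∑ s, p s = 1) (θ : Fin d → ℝ) :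
    0 < expMoment p θ := by
  obtain ⟨s, -, hs⟩ := Finset.exists_ne_zero_of_sum_ne_zero (hp1.trans_ne one_ne_zero)
  exact Finset.sum_pos' (fun s _ => mul_nonneg (Real.exp_pos _).le (hp s))
    ⟨s, Finset.mem_univ s, mul_pos (Real.exp_pos _) ((hp s).lt_of_ne' hs)⟩

theorem bddBelow_range_expMoment {p : S → ℝ} (hp : ∀ s, 0 ≤ p s) :
    BddBelow (Set.range fun θ => expMoment p θ) :=
  ⟨0, by rintro _ ⟨θ, rfl⟩; exact expMoment_nonneg hp θ⟩

theorem isLinearMap_expMoment (θ : Fin d → ℝ) :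
    IsLinearMap ℝ fun p : S → ℝ => expMoment p θ := by
  constructor
  · intro p q; simp [expMoment, mul_add, Finset.sum_add_distrib]
  · intro c p; simp only [expMoment, Pi.smul_apply, smul_eq_mul, Finset.mul_sum]
    exact Finset.sum_congr rfl fun s _ => by ring

theorem isLinearMap_expMomentGrad (θ : Fin d → ℝ) :
    IsLinearMap ℝ fun p : S → ℝ => expMomentGrad p θ := by
  constructor
  · intro p q; ext i; simp [expMomentGrad, mul_add, Finset.sum_add_distrib]
  · intro c p; ext i; simp only [expMomentGrad, Pi.smul_apply, smul_eq_mul, Finset.mul_sum]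
    exact Finset.sum_congr rfl fun s _ => by ring

theorem expMomentGrad_zero (p : S → ℝ) : expMomentGrad p 0 = drift p := by
  ext i
  simp [expMomentGrad, drift, pairing_zero]

theorem continuous_expMoment :
    Continuous fun a : (S → ℝ) × (Fin d → ℝ) => expMoment a.1 a.2 := by
  unfold expMoment
  fun_prop

theorem continuous_expMomentGrad :
    Continuous fun a : (S → ℝ) × (Fin d → ℝ) => expMomentGrad a.1 a.2 := by
  unfold expMomentGrad pairing
  fun_prop

theorem sum_mul_expMomentGrad (v : Fin d → ℝ) (p : S → ℝ) (θ : Fin d → ℝ) :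
    ∑ i, v i * expMomentGrad p θ i
      = ∑ s : S, pairing v s * (Real.exp (pairing θ s) * p s) := by
  simp only [expMomentGrad, pairing, Finset.mul_sum, Finset.sum_mul]
  rw [Finset.sum_comm]
  simp only [mul_assoc]

/-- The tangent inequality for the convex function `θ ↦ expMoment p θ`. -/
theorem expMoment_add_le {p : S → ℝ} (hp : ∀ s, 0 ≤ p s) (θ v : Fin d → ℝ) :
    expMoment p θ + ∑ i, v i * expMomentGrad p θ i ≤ expMoment p (θ + v) := by
  rw [sum_mul_expMomentGrad, expMoment_eq, expMoment_eq, ← Finset.sum_add_distrib]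
  refine Finset.sum_le_sum fun s _ => ?_
  rw [pairing_add_left, Real.exp_add]
  have h1 := Real.add_one_le_exp (pairing v (s : Fin d → ℤ))
  have h2 := mul_nonneg (Real.exp_pos (pairing θ (s : Fin d → ℤ))).le (hp s)
  nlinarith

theorem expMoment_le_of_grad_eq_zero {p : S → ℝ} (hp : ∀ s, 0 ≤ p s) {θ : Fin d → ℝ}
    (h : expMomentGrad p θ = 0) (θ' : Fin d → ℝ) : expMoment p θ ≤ expMoment p θ' := by
  have := expMoment_add_le hp θ (θ' - θ)
  simpa [h] using this

theorem iInf_expMoment_of_grad_eq_zero {p : S → ℝ} (hp : ∀ s, 0 ≤ p s) {θ : Fin d → ℝ}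
    (h : expMomentGrad p θ = 0) : ⨅ θ', expMoment p θ' = expMoment p θ :=
  le_antisymm (ciInf_le (bddBelow_range_expMoment hp) θ)
    (le_ciInf (expMoment_le_of_grad_eq_zero hp h))

theorem drift_eq_zero_of_forall_one_le {p : S → ℝ} (hp : ∑ s, p s = 1)
    (h : ∀ θ, 1 ≤ expMoment p θ) : drift p = 0 := by
  -- the drift is the gradient at the minimum `θ = 0`
  have hderiv : ∀ v : Fin d → ℝ,
      HasDerivAt (fun t : ℝ => expMoment p (t • v)) (∑ i, v i * drift p i) 0 := by
    intro v
    have h1 : (fun t : ℝ => expMoment p (t • v))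
        = fun t => ∑ s : S, Real.exp (t * pairing v s) * p s := by
      ext t
      simp only [expMoment_eq, pairing_smul]
    rw [h1, ← expMomentGrad_zero, sum_mul_expMomentGrad]
    refine HasDerivAt.fun_sum fun s _ => ?_
    have := (((hasDerivAt_id (0 : ℝ)).mul_const (pairing v s)).exp).mul_const (p s)
    refine this.congr_deriv ?_
    simp only [id, zero_mul, Real.exp_zero, pairing_zero]
    ring
  have hmin := fun v => IsLocalMin.hasDerivAt_eq_zero (f := fun t : ℝ => expMoment p (t • v))
    (Eventually.of_forall fun t => by
      simpa only [zero_smul, expMoment_zero hp] using h (t • v)) (hderiv v)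
  ext i
  simpa [Pi.single_apply] using hmin (Pi.single i 1)

/-! ### The saddle point -/

/-- `p` is a vector of probability weights giving mass at least `γ` to every step of `S'`. -/
structure IsElliptic (S' : Set S) (γ : ℝ) (p : S → ℝ) : Prop where
  nonneg : ∀ s, 0 ≤ p s
  sum_eq_one : ∑ s, p s = 1
  le_apply : ∀ s ∈ S', γ ≤ p s

/-- Uniform ellipticity bounds the set of `θ` where the exponential moment is at most `1`,
because every coordinate direction is a sum of boundedly many elliptic steps. -/
theorem exists_abs_le_of_expMoment_le_one {S' : Set S}
    (hS' : AddSubmonoid.closure (Subtype.val '' S' : Set (Fin d → ℤ)) = ⊤)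
    {γ : ℝ} (hγ : 0 < γ) :
    ∃ b : ℝ, 0 ≤ b ∧ ∀ p : S → ℝ, IsElliptic S' γ p → ∀ θ : Fin d → ℝ,
      expMoment p θ ≤ 1 → ∀ i, |θ i| ≤ b := by
  obtain ⟨ℓ, hℓ⟩ := exists_length_le_of_closure_eq_top hS'
  refine ⟨ℓ * |Real.log γ|, by positivity, fun p hp θ hθ i => ?_⟩
  have h1 : ∀ u ∈ (Subtype.val '' S' : Set (Fin d → ℤ)), pairing θ u ≤ |Real.log γ| := by
    rintro _ ⟨s, hs, rfl⟩
    have h2 : Real.exp (pairing θ s) * p s ≤ 1 :=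
      (Finset.single_le_sum (f := fun s : S => Real.exp (pairing θ s) * p s)
        (fun s _ => mul_nonneg (Real.exp_pos _).le (hp.nonneg s)) (Finset.mem_univ s)).trans hθ
    have h3 : Real.exp (pairing θ s) * γ ≤ 1 :=
      (mul_le_mul_of_nonneg_left (hp.le_apply s hs) (Real.exp_pos _).le).trans h2
    have h4 := Real.log_le_log (by positivity) h3
    rw [Real.log_mul (Real.exp_pos _).ne' hγ.ne', Real.log_exp, Real.log_one] at h4
    have := neg_abs_le (Real.log γ)
    linarith
  have h2 : ∀ l : List (Fin d → ℤ), (∀ u ∈ l, u ∈ (Subtype.val '' S' : Set (Fin d → ℤ))) →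
      pairing θ l.sum ≤ l.length * |Real.log γ| := by
    intro l hl
    induction l with
    | nil => simp [pairing]
    | cons u l ih =>
      have h3 := h1 u (hl u (by simp))
      have h4 := ih fun u hu => hl u (by simp [hu])
      rw [List.sum_cons, pairing_add_right, List.length_cons]
      push_cast
      linarith
  have h3 : ∀ e : ℤ, e.natAbs = 1 → θ i * e ≤ ℓ * |Real.log γ| := by
    intro e he
    obtain ⟨l, hl, hsum, hlen⟩ := hℓ (Pi.single i e)
    have h4 := h2 l hl
    have h5 : ∑ j, ((Pi.single i e : Fin d → ℤ) j).natAbs = 1 := by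
      rw [Fintype.sum_eq_single i fun j hj => by simp [hj]]
      simpa using he
    have h6 : pairing θ (Pi.single i e) = θ i * e := by
      rw [pairing, Fintype.sum_eq_single i fun j hj => by simp [hj]]
      simp
    rw [h5, mul_one] at hlen
    rw [hsum, h6] at h4
    exact h4.trans (mul_le_mul_of_nonneg_right (by exact_mod_cast hlen) (abs_nonneg _))
  have h4 := h3 1 rfl
  have h5 := h3 (-1) rfl
  push_cast at h4 h5
  rw [abs_le]
  constructor <;> linarith

/-- The worst exponential moment `max_{q ∈ A} expMoment q θ` over a compact elliptic set `A`
attains its minimum: there is `θ₀` such that for all `θ` some `q ∈ A` has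
`expMoment q θ ≥ M = max_{q ∈ A} expMoment q θ₀`. -/
theorem exists_minimax {S' : Set S}
    (hS' : AddSubmonoid.closure (Subtype.val '' S' : Set (Fin d → ℤ)) = ⊤)
    {γ : ℝ} (hγ : 0 < γ) {A : Set (S → ℝ)} (hA : IsCompact A) (hne : A.Nonempty)
    (hell : ∀ q ∈ A, IsElliptic S' γ q) :
    ∃ (θ₀ : Fin d → ℝ) (M : ℝ), (∀ q ∈ A, expMoment q θ₀ ≤ M) ∧
      ∀ θ, ∃ q ∈ A, M ≤ expMoment q θ := by
  obtain ⟨b, hb0, hb⟩ := exists_abs_le_of_expMoment_le_one hS' hγ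
  have hmax : ∀ θ : Fin d → ℝ, ∃ q ∈ A, ∀ q' ∈ A, expMoment q' θ ≤ expMoment q θ := fun θ =>
    hA.exists_isMaxOn hne
      (continuous_expMoment.comp (Continuous.prodMk continuous_id continuous_const)).continuousOn
  have hcont : Continuous fun θ : Fin d → ℝ => sSup ((fun q => expMoment q θ) '' A) :=
    hA.continuous_sSup (f := fun θ q => expMoment q θ)
      (continuous_expMoment.comp continuous_swap)
  have hval : ∀ θ : Fin d → ℝ, ∀ q ∈ A, (∀ q' ∈ A, expMoment q' θ ≤ expMoment q θ) →
      sSup ((fun q => expMoment q θ) '' A) = expMoment q θ := fun θ q hq h =>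
    IsGreatest.csSup_eq ⟨⟨q, hq, rfl⟩, by rintro _ ⟨q', hq', rfl⟩; exact h q' hq'⟩
  have hbox : IsCompact (Set.Icc (fun _ => -b) (fun _ => b) : Set (Fin d → ℝ)) := isCompact_Icc
  have h0 : (0 : Fin d → ℝ) ∈ Set.Icc (fun _ => -b) (fun _ => b) :=
    ⟨fun _ => by simpa using hb0, fun _ => hb0⟩
  obtain ⟨θ₀, hθ₀, hmin⟩ := hbox.exists_isMinOn ⟨0, h0⟩ hcont.continuousOn
  obtain ⟨q₀, hq₀, hq₀max⟩ := hmax θ₀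
  refine ⟨θ₀, expMoment q₀ θ₀, hq₀max, fun θ => ?_⟩
  by_cases hθ : θ ∈ Set.Icc (fun _ => -b) (fun _ => b)
  · obtain ⟨q, hq, hqmax⟩ := hmax θ
    refine ⟨q, hq, ?_⟩
    rw [← hval θ q hq hqmax, ← hval θ₀ q₀ hq₀ hq₀max]
    exact hmin hθ
  · -- off the box every moment exceeds `1`, the value at `θ = 0`
    obtain ⟨q, hq⟩ := hne
    refine ⟨q, hq, ?_⟩
    have h1 : 1 < expMoment q θ := by
      by_contra! hcon
      exact hθ ⟨fun i => (abs_le.1 (hb q (hell q hq) θ hcon i)).1,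
        fun i => (abs_le.1 (hb q (hell q hq) θ hcon i)).2⟩
    obtain ⟨q', hq', hmax'⟩ := hmax 0
    have h2 := hmin h0
    simp only [Set.mem_ofPred_eq] at h2
    rw [hval 0 q' hq' hmax', hval θ₀ q₀ hq₀ hq₀max, expMoment_zero (hell q' hq').sum_eq_one] at h2
    linarith

/-- At the minimax point, in every direction `v` some maximizing law has non-negative derivative.
It is a limit of maximizers at `θ₀ + t v` as `t ↓ 0`. -/
theorem exists_grad_nonneg {A : Set (S → ℝ)} (hA : IsCompact A) (hnn : ∀ q ∈ A, ∀ s, 0 ≤ q s)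
    {θ₀ : Fin d → ℝ} {M : ℝ} (hM : ∀ q ∈ A, expMoment q θ₀ ≤ M)
    (hmin : ∀ θ, ∃ q ∈ A, M ≤ expMoment q θ) (v : Fin d → ℝ) :
    ∃ q ∈ A, expMoment q θ₀ = M ∧ 0 ≤ ∑ i, v i * expMomentGrad q θ₀ i := by
  have ht : Tendsto (fun n : ℕ => θ₀ + (1 / ((n : ℝ) + 1)) • v) atTop (nhds θ₀) := by
    have := (tendsto_one_div_add_atTop_nhds_zero_nat (𝕜 := ℝ)).smul_const v
    simpa using this.const_add θ₀
  choose q hq hqM using fun n : ℕ => hmin (θ₀ + (1 / ((n : ℝ) + 1)) • v)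
  obtain ⟨q', hq', φ, hφ, hlim⟩ := hA.tendsto_subseq hq
  have hpair := hlim.prodMk_nhds (ht.comp hφ.tendsto_atTop)
  refine ⟨q', hq', le_antisymm (hM q' hq') ?_, ?_⟩
  · exact ge_of_tendsto' ((continuous_expMoment.tendsto (q', θ₀)).comp hpair)
      fun n => hqM (φ n)
  · have hc : Continuous fun a : (S → ℝ) × (Fin d → ℝ) => ∑ i, v i * expMomentGrad a.1 a.2 i :=
      continuous_finsetSum _ fun i _ =>
        continuous_const.mul ((continuous_apply i).comp continuous_expMomentGrad)
    refine ge_of_tendsto' ((hc.tendsto (q', θ₀)).comp hpair) fun n => ?_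
    set t : ℝ := 1 / ((φ n : ℝ) + 1) with ht
    have htpos : 0 < t := by positivity
    have h1 := expMoment_add_le (hnn _ (hq (φ n))) (θ₀ + t • v) (-(t • v))
    rw [add_neg_cancel_right] at h1
    have h2 := hM _ (hq (φ n))
    have h3 := hqM (φ n)
    have h4 : ∑ i, (-(t • v)) i * expMomentGrad (q (φ n)) (θ₀ + t • v) i
        = -(t * ∑ i, v i * expMomentGrad (q (φ n)) (θ₀ + t • v) i) := by
      rw [Finset.mul_sum, ← Finset.sum_neg_distrib]
      refine Finset.sum_congr rfl fun i _ => ?_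
      simp; ring
    rw [h4] at h1
    have h5 : 0 ≤ t * ∑ i, v i * expMomentGrad (q (φ n)) (θ₀ + t • v) i := by
      linarith
    exact nonneg_of_mul_nonneg_right h5 htpos

/-- The saddle point: some law in the convex hull of `A` attains the minimax value, and its
exponential moment is minimal at `θ₀`. Otherwise `0` would be separated from the compact convex set
of gradients of the maximizing laws, against `exists_grad_nonneg`. -/
theorem exists_mem_convexHull_grad_eq_zero {A : Set (S → ℝ)} (hA : IsCompact A)
    (hnn : ∀ q ∈ A, ∀ s, 0 ≤ q s)
    {θ₀ : Fin d → ℝ} {M : ℝ} (hM : ∀ q ∈ A, expMoment q θ₀ ≤ M)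
    (hmin : ∀ θ, ∃ q ∈ A, M ≤ expMoment q θ) :
    ∃ p ∈ convexHull ℝ A, expMoment p θ₀ = M ∧ expMomentGrad p θ₀ = 0 := by
  have hgc : Continuous fun q : S → ℝ => expMomentGrad q θ₀ :=
    continuous_expMomentGrad.comp (Continuous.prodMk continuous_id continuous_const)
  have hmc : Continuous fun q : S → ℝ => expMoment q θ₀ :=
    continuous_expMoment.comp (Continuous.prodMk continuous_id continuous_const)
  set A' : Set (S → ℝ) := A ∩ {q | expMoment q θ₀ = M} with hA'
  have hA'c : IsCompact A' := hA.inter_right (isClosed_eq hmc continuous_const)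
  have hH : IsCompact (convexHull ℝ A') := isCompact_convexHull_of_isCompact hA'c
  set G : Set (Fin d → ℝ) := (fun q => expMomentGrad q θ₀) '' convexHull ℝ A'
  have hGc : IsCompact G := hH.image hgc
  have hGconv : Convex ℝ G :=
    (convex_convexHull ℝ A').is_linear_image (isLinearMap_expMomentGrad θ₀)
  have h0 : (0 : Fin d → ℝ) ∈ G := by
    by_contra h0
    obtain ⟨f, u, hu0, hu⟩ := geometric_hahn_banach_point_closed hGconv hGc.isClosed h0
    rw [map_zero] at hu0
    obtain ⟨q, hq, hqM, hqg⟩ := exists_grad_nonneg hA hnn hM hmin (fun i => -f (Pi.single i 1))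
    have h1 := hu _ ⟨q, subset_convexHull ℝ A' ⟨hq, hqM⟩, rfl⟩
    have h2 : f (expMomentGrad q θ₀) = ∑ i, f (Pi.single i 1) * expMomentGrad q θ₀ i := by
      conv_lhs => rw [pi_eq_sum_univ' (expMomentGrad q θ₀)]
      rw [map_sum]
      refine Finset.sum_congr rfl fun i _ => ?_
      rw [map_smul, smul_eq_mul, mul_comm]
    simp only [neg_mul, Finset.sum_neg_distrib] at hqg
    rw [← h2] at hqg
    linarith
  obtain ⟨p, hp, hp0⟩ := h0
  refine ⟨p, convexHull_mono Set.inter_subset_left hp, ?_, hp0⟩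
  have hconv : Convex ℝ {q : S → ℝ | expMoment q θ₀ = M} :=
    convex_hyperplane (isLinearMap_expMoment θ₀) M
  exact convexHull_min Set.inter_subset_right hconv hp

theorem IsElliptic.of_mem_convexHull {S' : Set S} {γ : ℝ} {A : Set (S → ℝ)}
    (hell : ∀ q ∈ A, IsElliptic S' γ q) {p : S → ℝ} (hp : p ∈ convexHull ℝ A) :
    IsElliptic S' γ p := by
  have hconv : Convex ℝ {q : S → ℝ | IsElliptic S' γ q} := by
    intro p hp q hq a b ha hb hab
    refine ⟨fun s => ?_, ?_, fun s hs => ?_⟩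
    · exact add_nonneg (mul_nonneg ha (hp.nonneg s)) (mul_nonneg hb (hq.nonneg s))
    · simp only [Pi.add_apply, Pi.smul_apply, smul_eq_mul, Finset.sum_add_distrib,
        ← Finset.mul_sum]
      rw [hp.sum_eq_one, hq.sum_eq_one, mul_one, mul_one, hab]
    · calc γ = a * γ + b * γ := by rw [← add_mul, hab, one_mul]
        _ ≤ a * p s + b * q s := add_le_add (mul_le_mul_of_nonneg_left (hp.le_apply s hs) ha)
            (mul_le_mul_of_nonneg_left (hq.le_apply s hs) hb)
  exact convexHull_min hell hconv hp

end RWRE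

/-! ### Spectral radius of an elliptic environment -/

namespace RWRE

variable {d : ℕ} {S : Finset (Fin d → ℤ)} {S' : Set S} {γ : ℝ}

theorem IsElliptic.min_one {p : S → ℝ} (hp : IsElliptic S' γ p) : IsElliptic S' (min γ 1) p :=
  ⟨hp.nonneg, hp.sum_eq_one, fun s hs => (min_le_left _ _).trans (hp.le_apply s hs)⟩

theorem nStep_le_one {ω : (Fin d → ℤ) → (S → ℝ)} (hω : ∀ x, IsElliptic S' γ (ω x)) (n : ℕ)
    (x y : Fin d → ℤ) : nStep (envKernel ω) n x y ≤ 1 := by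
  simpa using nStep_mul_le_of_superharmonic (fun x => (hω x).nonneg) (f := fun _ => 1)
    (fun _ => zero_le_one) zero_le_one
    (fun x => by simpa only [mul_one] using (hω x).sum_eq_one.le) n x y

theorem nStep_self_le_pow {ω : (Fin d → ℤ) → (S → ℝ)} (hω : ∀ x s, 0 ≤ ω x s)
    {θ : Fin d → ℝ} {M : ℝ} (hM0 : 0 ≤ M) (hM : ∀ x, expMoment (ω x) θ ≤ M) (n : ℕ)
    (x : Fin d → ℤ) : nStep (envKernel ω) n x x ≤ M ^ n := by
  refine le_of_mul_le_mul_right (nStep_mul_le_of_superharmonic hω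
    (f := fun y => Real.exp (pairing θ y)) (fun _ => (Real.exp_pos _).le) hM0 (fun x => ?_) n x x)
    (Real.exp_pos _)
  calc ∑ s : S, ω x s * Real.exp (pairing θ (x + s))
      = expMoment (ω x) θ * Real.exp (pairing θ x) := by
        rw [expMoment_eq, Finset.sum_mul]
        refine Finset.sum_congr rfl fun s _ => ?_
        rw [pairing_add_right, Real.exp_add]; ring
    _ ≤ M * Real.exp (pairing θ x) := mul_le_mul_of_nonneg_right (hM x) (Real.exp_pos _).le

theorem spectralRadius_le {ω : (Fin d → ℤ) → (S → ℝ)} (hω : ∀ x s, 0 ≤ ω x s)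
    {θ : Fin d → ℝ} {M : ℝ} (hM0 : 0 ≤ M) (hM : ∀ x, expMoment (ω x) θ ≤ M) (x : Fin d → ℤ) :
    spectralRadius (envKernel ω) x ≤ M := by
  refine limsup_le_of_le ?_ ?_
  · exact IsCoboundedUnder.of_frequently_ge (a := 0) (Frequently.of_forall fun n =>
      Real.rpow_nonneg (nStep_envKernel_nonneg hω n x x) _)
  · filter_upwards [eventually_ge_atTop 1] with n hn
    have h1 := Real.rpow_le_rpow (nStep_envKernel_nonneg hω n x x)
      (nStep_self_le_pow hω hM0 hM n x) (by positivity : (0 : ℝ) ≤ 1 / (n : ℝ))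
    rwa [one_div, Real.pow_rpow_inv_natCast hM0 (by omega), ← one_div] at h1

theorem spectralRadius_le_one {ω : (Fin d → ℤ) → (S → ℝ)} (hω : ∀ x, IsElliptic S' γ (ω x))
    (x : Fin d → ℤ) : spectralRadius (envKernel ω) x ≤ 1 :=
  spectralRadius_le (fun x => (hω x).nonneg) (θ := 0) zero_le_one
    (fun x => (expMoment_zero (hω x).sum_eq_one).le) x

theorem isBoundedUnder_nStep_rpow {ω : (Fin d → ℤ) → (S → ℝ)}
    (hω : ∀ x, IsElliptic S' γ (ω x)) (x : Fin d → ℤ) :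
    IsBoundedUnder (· ≤ ·) atTop
      fun n : ℕ => (nStep (envKernel ω) n x x) ^ (1 / (n : ℝ)) :=
  isBoundedUnder_of ⟨1, fun n => Real.rpow_le_one
    (nStep_envKernel_nonneg (fun x => (hω x).nonneg) n x x) (nStep_le_one hω n x x)
    (by positivity)⟩

theorem spectralRadius_nonneg {ω : (Fin d → ℤ) → (S → ℝ)} (hω : ∀ x, IsElliptic S' γ (ω x))
    (x : Fin d → ℤ) : 0 ≤ spectralRadius (envKernel ω) x :=
  le_limsup_of_frequently_le (Frequently.of_forall fun n =>
      Real.rpow_nonneg (nStep_envKernel_nonneg (fun x => (hω x).nonneg) n x x) _)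
    (isBoundedUnder_nStep_rpow hω x)

/-- By supermultiplicativity and irreducibility, the spectral radius at `x` dominates the
`n`-step return probability at every state `z`. -/
theorem nStep_le_spectralRadius_pow
    (hS' : AddSubmonoid.closure (Subtype.val '' S' : Set (Fin d → ℤ)) = ⊤) (hγ : 0 < γ)
    {ω : (Fin d → ℤ) → (S → ℝ)} (hω : ∀ x, IsElliptic S' γ (ω x)) (n : ℕ) (x z : Fin d → ℤ) :
    nStep (envKernel ω) n z z ≤ spectralRadius (envKernel ω) x ^ n := by
  have hnn : ∀ x s, 0 ≤ ω x s := fun x => (hω x).nonneg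
  obtain ⟨ℓ, hℓ⟩ := exists_length_le_of_closure_eq_top hS'
  have hreach : ∀ x y, ∃ m, 0 < nStep (envKernel ω) m x y := by
    intro x y
    obtain ⟨l, hl, hsum, -⟩ := hℓ (y - x)
    refine ⟨l.length, ?_⟩
    have h1 := pow_le_nStep_of_sum hnn hγ.le (fun x => (hω x).le_apply) l hl x
    rw [hsum, add_sub_cancel] at h1
    exact (pow_pos hγ _).trans_le h1
  obtain ⟨a, ha⟩ := hreach x z
  obtain ⟨b, hb⟩ := hreach z x
  rcases Nat.eq_zero_or_pos n with rfl | hn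
  · simp [nStep_envKernel_zero]
  set u := nStep (envKernel ω) n z z with hu
  have hu0 : 0 ≤ u := nStep_envKernel_nonneg hnn n z z
  by_contra! hlt
  set ρ := spectralRadius (envKernel ω) x with hρ
  have hρ0 : 0 ≤ ρ := spectralRadius_nonneg hω x
  -- a level `c` with `ρ < c` and `cⁿ < u`
  obtain ⟨c, hc, hcu⟩ : ∃ c, ρ < c ∧ c ^ n < u := by
    have hev : ∀ᶠ c in nhdsWithin ρ (Set.Ioi ρ), c ^ n < u :=
      (((continuous_pow n).tendsto ρ).eventually_lt_const hlt).filter_mono nhdsWithin_le_nhds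
    obtain ⟨c, h1, h2⟩ := (hev.and self_mem_nhdsWithin).exists
    exact ⟨c, h2, h1⟩
  have hc0 : 0 < c := hρ0.trans_lt hc
  have hev : ∀ᶠ m : ℕ in atTop, nStep (envKernel ω) m x x < c ^ m := by
    filter_upwards [eventually_lt_of_limsup_lt hc (isBoundedUnder_nStep_rpow hω x),
      eventually_ge_atTop 1] with m hm hm1
    have hp := nStep_envKernel_nonneg hnn m x x
    have h1 := pow_lt_pow_left₀ hm (Real.rpow_nonneg hp _) (by omega : m ≠ 0)
    rwa [one_div, Real.rpow_inv_natCast_pow hp (by omega)] at h1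
  obtain ⟨m₀, hm₀⟩ := eventually_atTop.1 hev
  set δ := nStep (envKernel ω) a x z * nStep (envKernel ω) b z x with hδ
  have hδ0 : 0 < δ := mul_pos ha hb
  have hbound : ∀ k ≥ m₀, (u / c ^ n) ^ k ≤ c ^ (a + b) / δ := by
    intro k hk
    have h1 := hm₀ (a + n * k + b) (by
      have := Nat.le_mul_of_pos_left k hn
      omega)
    have h2 := nStep_mul_nStep_le hnn (a + n * k) b x z x
    have h3 := nStep_mul_nStep_le hnn a (n * k) x z z
    have h4 := nStep_pow_le hnn n k z
    have h5 : δ * u ^ k ≤ c ^ (a + n * k + b) :=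
      calc δ * u ^ k = nStep (envKernel ω) a x z * u ^ k * nStep (envKernel ω) b z x := by
            rw [hδ]; ring
        _ ≤ nStep (envKernel ω) a x z * nStep (envKernel ω) (n * k) z z
              * nStep (envKernel ω) b z x := by gcongr
        _ ≤ _ := (mul_le_mul_of_nonneg_right h3 hb.le).trans (h2.trans h1.le)
    rw [div_pow, div_le_div_iff₀ (by positivity) hδ0]
    calc u ^ k * δ = δ * u ^ k := mul_comm _ _
      _ ≤ c ^ (a + n * k + b) := h5
      _ = c ^ (a + b) * (c ^ n) ^ k := by rw [← pow_mul]; ring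
  have hratio : 1 < u / c ^ n := (one_lt_div (by positivity)).2 hcu
  obtain ⟨k, hk, hk'⟩ := ((tendsto_pow_atTop_atTop_of_one_lt hratio).eventually_gt_atTop
    (c ^ (a + b) / δ)).and (eventually_ge_atTop m₀) |>.exists
  exact absurd (hbound k hk') (not_le.2 hk)

/-! ### Trapping patterns -/

/-- The `ℓ¹` size of a lattice point. -/
def size (x : Fin d → ℤ) : ℕ := ∑ i, (x i).natAbs

theorem size_add_le (x y : Fin d → ℤ) : size (x + y) ≤ size x + size y := by
  rw [size, size, size, ← Finset.sum_add_distrib]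
  exact Finset.sum_le_sum fun i _ => Int.natAbs_add_le _ _

theorem size_neg (x : Fin d → ℤ) : size (-x) = size x := by simp [size]

/-- The box of lattice points all of whose coordinates are at most `r` in absolute value. -/
noncomputable def box (d r : ℕ) : Finset (Fin d → ℤ) :=
  Finset.Icc (fun _ => -(r : ℤ)) fun _ => (r : ℤ)

theorem mem_box {r : ℕ} {y : Fin d → ℤ} : y ∈ box d r ↔ ∀ i, (y i).natAbs ≤ r := by
  simp only [box, Finset.mem_Icc, Pi.le_def, ← forall_and]
  exact forall_congr' fun i => by omega

theorem card_box (d r : ℕ) : (box d r).card = (2 * r + 1) ^ d := by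
  rw [box, Pi.card_Icc]
  simp only [Int.card_Icc, Finset.prod_const, Finset.card_univ, Fintype.card_fin]
  congr 1; omega

theorem size_le_of_mem_box {r : ℕ} {y : Fin d → ℤ} (hy : y ∈ box d r) : size y ≤ d * r := by
  simpa [size] using Finset.sum_le_card_nsmul Finset.univ (fun i => (y i).natAbs) r
    fun i _ => mem_box.1 hy i

theorem pairing_le_of_mem_box (θ : Fin d → ℝ) {r : ℕ} {y : Fin d → ℤ} (hy : y ∈ box d r) :
    pairing θ y ≤ (∑ i, |θ i|) * r := by
  rw [pairing, Finset.sum_mul]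
  refine Finset.sum_le_sum fun i _ => (le_abs_self _).trans ?_
  rw [abs_mul]
  refine mul_le_mul_of_nonneg_left ?_ (abs_nonneg _)
  have h1 := mem_box.1 hy i
  rw [← Int.cast_abs, Int.abs_eq_natAbs]
  exact_mod_cast h1

/-- A pattern of step weights is trapping with respect to `θ` and `M`, if after tilting by `θ` all
weights have total mass `M`, and their drift at `y` does not point away from the origin. -/
structure IsTrap (θ : Fin d → ℝ) (M : ℝ) (π : (Fin d → ℤ) → (S → ℝ)) : Prop where
  nonneg : ∀ y s, 0 ≤ π y s
  expMoment_eq : ∀ y, expMoment (π y) θ = M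
  grad_le : ∀ y, ∑ i, (y i : ℝ) * expMomentGrad (π y) θ i ≤ 0

/-- In a trapping pattern the squared norm is a Lyapunov function for the tilted walk, so after `n`
steps half of its mass `Mⁿ` is still in a box of radius `r` of order `√n`, and some point of the box
carries at least the average share. -/
theorem IsTrap.exists_le_nStep {θ : Fin d → ℝ} {M : ℝ} {π : (Fin d → ℤ) → (S → ℝ)}
    (h : IsTrap θ M π) (hM : 0 < M) {C : ℕ} (hC : ∀ s ∈ S, ∑ i, (s i : ℝ) ^ 2 ≤ C)
    {r n : ℕ} (hr : 0 < r) (hn : 2 * C * n ≤ r ^ 2) :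
    ∃ y ∈ box d r, M ^ n / (2 * (2 * r + 1) ^ d)
      ≤ Real.exp (pairing θ y) * nStep (envKernel π) n 0 y := by
  set w : (Fin d → ℤ) → (S → ℝ) := fun v s => Real.exp (pairing θ s) * π v s with hwdef
  have hw : ∀ x s, 0 ≤ w x s := fun x s => mul_nonneg (Real.exp_pos _).le (h.nonneg x s)
  have hwM : ∀ x, ∑ s : S, w x s = M := h.expMoment_eq
  have hr0 : (0 : ℝ) < (r : ℝ) ^ 2 := by positivity
  have hlyap : ∀ x : Fin d → ℤ,
      ∑ s : S, w x s * (∑ i, (((x + s : Fin d → ℤ) i : ℤ) : ℝ) ^ 2)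
        ≤ M * (∑ i, ((x i : ℤ) : ℝ) ^ 2 + C) := by
    intro x
    have h1 : ∑ s : S, w x s * pairing (fun i => (x i : ℝ)) s ≤ 0 := by
      have := h.grad_le x
      rw [sum_mul_expMomentGrad] at this
      refine le_of_eq_of_le (Finset.sum_congr rfl fun s _ => ?_) this
      rw [mul_comm]
    have h2 : ∑ s : S, w x s * ∑ i, (((s : Fin d → ℤ) i : ℤ) : ℝ) ^ 2 ≤ M * C := by
      rw [← hwM x, Finset.sum_mul]
      exact Finset.sum_le_sum fun s _ => mul_le_mul_of_nonneg_left (hC s s.2) (hw x s)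
    have h3 : ∑ s : S, w x s * (∑ i, (((x + s : Fin d → ℤ) i : ℤ) : ℝ) ^ 2)
        = M * ∑ i, ((x i : ℤ) : ℝ) ^ 2 + 2 * ∑ s : S, w x s * pairing (fun i => (x i : ℝ)) s
          + ∑ s : S, w x s * ∑ i, (((s : Fin d → ℤ) i : ℤ) : ℝ) ^ 2 := by
      rw [← hwM x, Finset.sum_mul, Finset.mul_sum, ← Finset.sum_add_distrib,
        ← Finset.sum_add_distrib]
      refine Finset.sum_congr rfl fun s _ => ?_
      have : ∑ i, (((x + s : Fin d → ℤ) i : ℤ) : ℝ) ^ 2 = ∑ i, ((x i : ℤ) : ℝ) ^ 2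
          + 2 * pairing (fun i => (x i : ℝ)) s
          + ∑ i, (((s : Fin d → ℤ) i : ℤ) : ℝ) ^ 2 := by
        rw [pairing, Finset.mul_sum, ← Finset.sum_add_distrib, ← Finset.sum_add_distrib]
        refine Finset.sum_congr rfl fun i _ => ?_
        push_cast [Pi.add_apply]; ring
      rw [this]; ring
    rw [h3]; linarith
  have hB : ∀ y, y ∉ box d r → (r : ℝ) ^ 2 ≤ ∑ i, ((y i : ℤ) : ℝ) ^ 2 := by
    intro y hy
    simp only [mem_box, not_forall, not_le] at hy
    obtain ⟨i, hi⟩ := hy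
    refine le_trans ?_ (Finset.single_le_sum (f := fun i => ((y i : ℤ) : ℝ) ^ 2)
      (fun i _ => sq_nonneg _) (Finset.mem_univ i))
    have h1 : (r : ℝ) ≤ |(y i : ℝ)| := by
      rw [← Int.cast_abs, Int.abs_eq_natAbs]
      exact_mod_cast hi.le
    calc (r : ℝ) ^ 2 ≤ |(y i : ℝ)| ^ 2 := by gcongr
      _ = _ := sq_abs _
  have key := le_sum_nStep_of_lyapunov hw hwM
    (V := fun x => ∑ i, ((x i : ℤ) : ℝ) ^ 2)
    (fun x => Finset.sum_nonneg fun i _ => sq_nonneg _) hr0 hlyap hB n 0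
  have hhalf : M ^ n / 2 ≤ ∑ y ∈ box d r, nStep (envKernel w) n 0 y := by
    refine le_trans ?_ key
    have h1 : (C * n : ℝ) / (r : ℝ) ^ 2 ≤ 1 / 2 := by
      rw [div_le_div_iff₀ hr0 two_pos]
      have : (2 * C * n : ℝ) ≤ (r : ℝ) ^ 2 := by exact_mod_cast hn
      linarith
    simp only [Pi.zero_apply, Int.cast_zero, ne_eq, OfNat.ofNat_ne_zero, not_false_eq_true,
      zero_pow, Finset.sum_const_zero, zero_add]
    rw [div_eq_mul_inv]
    refine mul_le_mul_of_nonneg_left ?_ (pow_nonneg hM.le n)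
    linarith
  have hcard : 0 < ((2 * r + 1) ^ d : ℝ) := by positivity
  obtain ⟨y, hy, hle⟩ : ∃ y ∈ box d r,
      M ^ n / (2 * (2 * r + 1) ^ d) ≤ nStep (envKernel w) n 0 y := by
    by_contra! hcon
    have hne : (box d r).Nonempty := ⟨0, mem_box.2 fun i => by simp⟩
    have h1 := Finset.sum_lt_sum_of_nonempty hne hcon
    rw [Finset.sum_const, card_box, nsmul_eq_mul] at h1
    have h2 : (((2 * r + 1) ^ d : ℕ) : ℝ) * (M ^ n / (2 * (2 * r + 1) ^ d)) = M ^ n / 2 := by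
      push_cast; field_simp
    rw [h2] at h1
    linarith
  refine ⟨y, hy, hle.trans (le_of_eq ?_)⟩
  have := nStep_tilt π (fun x => Real.exp (pairing θ x))
    (fun x y => by simp only [pairing_add_right, Real.exp_add]) n 0 y
  rw [show pairing θ (0 : Fin d → ℤ) = 0 by simp [pairing], Real.exp_zero, one_mul] at this
  exact this

/-- If an elliptic environment contains, up to a factor `c`, arbitrarily large copies of a
trapping pattern, then its spectral radius is at least `c M`: the walk in the copy of size `n` is
typically at distance of order `√n` after `n` steps, and by ellipticity the way back costs a factor
that is only exponential in `√n`. -/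
theorem IsTrap.mul_le_spectralRadius
    (hS' : AddSubmonoid.closure (Subtype.val '' S' : Set (Fin d → ℤ)) = ⊤) (hγ : 0 < γ)
    {ω : (Fin d → ℤ) → (S → ℝ)} (hω : ∀ x, IsElliptic S' γ (ω x))
    {θ : Fin d → ℝ} {M : ℝ} {π : (Fin d → ℤ) → (S → ℝ)}
    (h : IsTrap θ M π) (hM : 0 < M) {c : ℝ} (hc : 0 < c)
    (hrich : ∀ N : ℕ, ∃ z, ∀ y, size y ≤ N → ∀ s, c * π y s ≤ ω (z + y) s) (x : Fin d → ℤ) :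
    c * M ≤ spectralRadius (envKernel ω) x := by
  wlog hγ1 : γ ≤ 1 generalizing γ
  · exact this (lt_min hγ one_pos) (fun x => (hω x).min_one) (min_le_right _ _)
  have hnn : ∀ x s, 0 ≤ ω x s := fun x => (hω x).nonneg
  set ρ := spectralRadius (envKernel ω) x with hρ
  have hρ0 : 0 ≤ ρ := spectralRadius_nonneg hω x
  have hρ1 : ρ ≤ 1 := spectralRadius_le_one hω x
  obtain ⟨ℓ, hℓ⟩ := exists_length_le_of_closure_eq_top hS'
  obtain ⟨C, hC0, hC⟩ : ∃ C : ℕ, 0 < C ∧ ∀ s ∈ S, ∑ i, (s i : ℝ) ^ 2 ≤ C := by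
    obtain ⟨C, hC⟩ := exists_nat_ge (∑ s ∈ S, ∑ i, (s i : ℝ) ^ 2)
    refine ⟨C + 1, Nat.succ_pos _, fun s hs => ?_⟩
    have := Finset.single_le_sum (f := fun s : Fin d → ℤ => ∑ i, (s i : ℝ) ^ 2)
      (fun s _ => Finset.sum_nonneg fun i _ => sq_nonneg _) hs
    push_cast
    linarith
  set R := ∑ s ∈ S, size s with hR
  have hsize : ∀ (x : Fin d → ℤ) (s : S), size (x + (s : Fin d → ℤ)) ≤ size x + R := fun x s =>
    (size_add_le _ _).trans (Nat.add_le_add_left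
      (Finset.single_le_sum (f := size) (fun _ _ => Nat.zero_le _) s.2) _)
  set T := ∑ i, |θ i| with hT
  set a := Real.exp (-(T + 2 * d + 1)) * γ ^ (ℓ * d) with ha
  have ha0 : 0 < a := mul_pos (Real.exp_pos _) (pow_pos hγ _)
  have key : ∀ k : ℕ, 0 < k → (c * M) ^ k * a ≤ ρ ^ k := by
    intro k hk
    -- `r ^ 2 = 2 * C * n` balances the time `n` and the distance `r` to return from
    set r := 2 * C * k with hr
    have hr0 : 0 < r := by positivity
    set n := k * r with hn
    obtain ⟨y, hy, hle⟩ := h.exists_le_nStep hM hC (r := r) (n := n) hr0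
      (le_of_eq (by rw [hn, hr]; ring))
    obtain ⟨z, hz⟩ := hrich (R * n)
    have h1 : c ^ n * nStep (envKernel π) n 0 y ≤ nStep (envKernel ω) n z (z + y) := by
      have h2 := pow_mul_nStep_le (ω := fun v => ω (z + v)) h.nonneg hc.le hsize hz n 0 y
        (by simp [size])
      rwa [nStep_envKernel_shift, add_zero] at h2
    obtain ⟨l, hl, hsum, hlen⟩ := hℓ (-y)
    set m := l.length with hm
    have h2 : γ ^ (ℓ * d * r) ≤ nStep (envKernel ω) m (z + y) z := by
      have h3 := pow_le_nStep_of_sum hnn hγ.le (fun x => (hω x).le_apply) l hl (z + y)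
      rw [hsum, add_neg_cancel_right] at h3
      refine le_trans (pow_le_pow_of_le_one hγ.le hγ1 (hlen.trans ?_)) h3
      rw [mul_assoc]
      exact Nat.mul_le_mul_left ℓ ((size_neg y).trans_le (size_le_of_mem_box hy))
    have h3 : nStep (envKernel ω) n z (z + y) * nStep (envKernel ω) m (z + y) z ≤ ρ ^ n :=
      (nStep_mul_nStep_le hnn n m z (z + y) z).trans
        ((nStep_le_spectralRadius_pow hS' hγ hω (n + m) x z).trans
          (pow_le_pow_of_le_one hρ0 hρ1 (Nat.le_add_right n m)))
    have h4 : M ^ n * Real.exp (-(T + 2 * d + 1)) ^ r ≤ nStep (envKernel π) n 0 y := by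
      have h5 : Real.exp (pairing θ y) ≤ Real.exp (T * r) :=
        Real.exp_le_exp.2 (pairing_le_of_mem_box θ hy)
      have h6 : (2 * (2 * r + 1) ^ d : ℝ) ≤ Real.exp r * Real.exp (2 * r) ^ d := by
        have h7 : (2 : ℝ) ≤ Real.exp r := by
          have := Real.add_one_le_exp (r : ℝ)
          have : (1 : ℝ) ≤ r := by exact_mod_cast hr0
          linarith
        have h8 := Real.add_one_le_exp (2 * r : ℝ)
        gcongr
      have h7 : M ^ n ≤ (Real.exp (T * r) * nStep (envKernel π) n 0 y)
          * (Real.exp r * Real.exp (2 * r) ^ d) := by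
        have hp := nStep_envKernel_nonneg h.nonneg n 0 y
        rw [div_le_iff₀ (by positivity)] at hle
        exact hle.trans (by gcongr)
      have h8 : Real.exp (T * r) * (Real.exp r * Real.exp (2 * r) ^ d)
          * Real.exp (-(T + 2 * d + 1)) ^ r = 1 := by
        rw [← Real.exp_nat_mul, ← Real.exp_nat_mul, ← Real.exp_add, ← Real.exp_add,
          ← Real.exp_add, Real.exp_eq_one_iff]
        ring
      calc M ^ n * Real.exp (-(T + 2 * d + 1)) ^ r
          ≤ (Real.exp (T * r) * nStep (envKernel π) n 0 y)
            * (Real.exp r * Real.exp (2 * r) ^ d) * Real.exp (-(T + 2 * d + 1)) ^ r := by gcongr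
        _ = nStep (envKernel π) n 0 y * (Real.exp (T * r) * (Real.exp r * Real.exp (2 * r) ^ d)
          * Real.exp (-(T + 2 * d + 1)) ^ r) := by ring
        _ = _ := by rw [h8, mul_one]
    have h5 : ((c * M) ^ k * a) ^ r ≤ (ρ ^ k) ^ r := by
      rw [← pow_mul, ← hn]
      refine le_trans ?_ h3
      calc ((c * M) ^ k * a) ^ r
          = (c ^ n * (M ^ n * Real.exp (-(T + 2 * d + 1)) ^ r)) * γ ^ (ℓ * d * r) := by
            rw [ha, hn, pow_mul c, pow_mul M, pow_mul γ (ℓ * d), mul_pow, mul_pow, mul_pow]; ring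
        _ ≤ (c ^ n * nStep (envKernel π) n 0 y) * γ ^ (ℓ * d * r) := by gcongr
        _ ≤ _ := mul_le_mul h1 h2 (pow_nonneg hγ.le _) (nStep_envKernel_nonneg hnn _ _ _)
    exact le_of_pow_le_pow_left₀ hr0.ne' (pow_nonneg hρ0 k) h5
  by_contra! hlt
  have hcM : 0 < c * M := mul_pos hc hM
  obtain ⟨k, hk⟩ := exists_pow_lt_of_lt_one ha0 ((div_lt_one hcM).2 hlt)
  have h1 := key (k + 1) (Nat.succ_pos k)
  have h2 : a ≤ (ρ / (c * M)) ^ (k + 1) := by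
    rw [div_pow, le_div_iff₀ (by positivity)]
    linarith
  have h3 : (ρ / (c * M)) ^ (k + 1) ≤ (ρ / (c * M)) ^ k :=
    pow_le_pow_of_le_one (by positivity) ((div_lt_one hcM).2 hlt).le (Nat.le_succ k)
  linarith

/-- The spectral radius of an elliptic environment whose exponential moments at `θ` are at most
`M`, and which contains arbitrarily large and precise copies of a trapping pattern. -/
theorem IsTrap.spectralRadius_eq
    (hS' : AddSubmonoid.closure (Subtype.val '' S' : Set (Fin d → ℤ)) = ⊤) (hγ : 0 < γ)
    {ω : (Fin d → ℤ) → (S → ℝ)} (hω : ∀ x, IsElliptic S' γ (ω x))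
    {θ : Fin d → ℝ} {M : ℝ} (hωM : ∀ x, expMoment (ω x) θ ≤ M)
    {π : (Fin d → ℤ) → (S → ℝ)} (h : IsTrap θ M π)
    (hrich : ∀ j N : ℕ, ∃ z, ∀ y, size y ≤ N → ∀ s,
      (1 - 1 / ((j : ℝ) + 2)) * π y s ≤ ω (z + y) s) (x : Fin d → ℤ) :
    spectralRadius (envKernel ω) x = M := by
  have hM : 0 < M := (expMoment_pos (hω 0).nonneg (hω 0).sum_eq_one θ).trans_le (hωM 0)
  refine le_antisymm (spectralRadius_le (fun x => (hω x).nonneg) hM.le hωM x) ?_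
  have hlim : Tendsto (fun j : ℕ => (1 - 1 / ((j : ℝ) + 2)) * M) atTop (nhds ((1 - 0) * M)) := by
    refine (tendsto_const_nhds.sub ?_).mul_const M
    have := (tendsto_add_atTop_iff_nat 1).2 (tendsto_one_div_add_atTop_nhds_zero_nat (𝕜 := ℝ))
    refine this.congr fun j => ?_
    push_cast; ring
  rw [sub_zero, one_mul] at hlim
  refine le_of_tendsto' hlim fun j => ?_
  refine h.mul_le_spectralRadius hS' hγ hω hM ?_ (hrich j) x
  have : (1 : ℝ) / ((j : ℝ) + 2) < 1 := by
    rw [div_lt_one (by positivity)]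
    have : (0 : ℝ) ≤ j := Nat.cast_nonneg j
    linarith
  linarith

/-- Cramér's formula for the return probabilities of a homogeneous elliptic walk. -/
theorem spectralRadius_homKernel
    (hS' : AddSubmonoid.closure (Subtype.val '' S' : Set (Fin d → ℤ)) = ⊤) (hγ : 0 < γ)
    {p : S → ℝ} (hp : IsElliptic S' γ p) (x : Fin d → ℤ) :
    spectralRadius (homKernel p) x = ⨅ θ, expMoment p θ := by
  have hell : ∀ q ∈ ({p} : Set (S → ℝ)), IsElliptic S' γ q := by rintro _ rfl; exact hp
  obtain ⟨θ, M, hM, hmin⟩ := exists_minimax hS' hγ isCompact_singleton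
    (Set.singleton_nonempty p) hell
  obtain ⟨p', hp', hpM, hgrad⟩ := exists_mem_convexHull_grad_eq_zero isCompact_singleton
    (fun q hq => (hell q hq).nonneg) hM hmin
  rw [convexHull_singleton, Set.mem_singleton_iff] at hp'
  subst hp'
  rw [iInf_expMoment_of_grad_eq_zero hp.nonneg hgrad, hpM]
  have htrap : IsTrap θ M fun _ : Fin d → ℤ => p' :=
    ⟨fun _ => hp.nonneg, fun _ => hpM, fun y => by simp [hgrad]⟩
  refine htrap.spectralRadius_eq hS' hγ (fun _ => hp) (fun _ => hpM.le)
    (fun j N => ⟨0, fun y _ s => ?_⟩) x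
  refine mul_le_of_le_one_left (hp.nonneg s) ?_
  have : (0 : ℝ) ≤ 1 / ((j : ℝ) + 2) := by positivity
  linarith

end RWRE

/-! ### Patterns in an i.i.d. environment -/

namespace RWRE

/-- In an i.i.d. family indexed by `ℕ × β` with `β` finite, some row almost surely shows a
given pattern of events of positive probability. -/
theorem ae_exists_forall_mem_of_prod {X β : Type*} [MeasurableSpace X] [Fintype β]
    (Q : Measure X) [IsProbabilityMeasure Q] {A : β → Set X} (hA : ∀ b, MeasurableSet (A b))
    (hpos : ∀ b, 0 < Q (A b)) :
    ∀ᵐ ω ∂(Measure.infinitePi fun _ : ℕ × β => Q), ∃ k, ∀ b, ω (k, b) ∈ A b := by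
  set E : ℕ → Set (ℕ × β → X) := fun k => {ω | ∀ b, ω (k, b) ∈ A b} with hE
  have hEm : ∀ k, MeasurableSet (E k) := fun k => by
    have : E k = ⋂ b, (fun ω : ℕ × β → X => ω (k, b)) ⁻¹' A b := by ext; simp [hE]
    rw [this]
    exact MeasurableSet.iInter fun b => measurable_pi_apply _ (hA b)
  have hmeas : ∀ s : Finset ℕ, Measure.infinitePi (fun _ : ℕ × β => Q) (⋂ k ∈ s, E k)
      = ∏ _k ∈ s, ∏ b, Q (A b) := by
    intro s
    have : (⋂ k ∈ s, E k)
        = Set.pi ((s ×ˢ Finset.univ : Finset (ℕ × β)) : Set (ℕ × β)) fun p => A p.2 := by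
      ext ω
      simp only [hE, Set.mem_iInter, Set.mem_ofPred_eq, Set.mem_pi, Finset.coe_product,
        Finset.coe_univ, Set.mem_prod, Set.mem_univ, and_true, Finset.mem_coe, Prod.forall]
      exact forall_congr' fun k => forall_comm
    rw [this, Measure.infinitePi_pi _ fun p _ => hA p.2, Finset.prod_product]
  have hone : ∀ k, Measure.infinitePi (fun _ : ℕ × β => Q) (E k) = ∏ b, Q (A b) := fun k => by
    simpa using hmeas {k}
  have hind : ProbabilityTheory.iIndepSet E (Measure.infinitePi fun _ : ℕ × β => Q) := by
    rw [ProbabilityTheory.iIndepSet_iff_meas_biInter hEm]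
    intro s
    rw [hmeas]
    exact Finset.prod_congr rfl fun k _ => (hone k).symm
  have hsum : ∑' k, Measure.infinitePi (fun _ : ℕ × β => Q) (E k) = ⊤ := by
    simp only [hone]
    exact ENNReal.tsum_const_eq_top_of_ne_zero (Finset.prod_ne_zero_iff.2 fun b _ => (hpos b).ne')
  have hlim := ProbabilityTheory.measure_limsup_eq_one hEm hind hsum
  rw [prob_compl_eq_zero_iff (MeasurableSet.measurableSet_limsup hEm) |>.symm] at hlim
  have hae : ∀ᵐ ω ∂(Measure.infinitePi fun _ : ℕ × β => Q), ω ∈ limsup E atTop := hlim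
  filter_upwards [hae] with ω hω
  rw [mem_limsup_iff_frequently_mem] at hω
  exact hω.exists

theorem ae_exists_forall_mem {ι X β : Type*} [MeasurableSpace X] [Fintype β]
    (Q : Measure X) [IsProbabilityMeasure Q] {A : β → Set X} (hA : ∀ b, MeasurableSet (A b))
    (hpos : ∀ b, 0 < Q (A b)) {f : ℕ × β → ι} (hf : Function.Injective f) :
    ∀ᵐ ω ∂(Measure.infinitePi fun _ : ι => Q), ∃ k, ∀ b, ω (f (k, b)) ∈ A b := by
  have h := ae_exists_forall_mem_of_prod Q hA hpos
  rw [← Measure.map_infinitePi_infinitePi_of_inj (P := fun _ : ι => Q) hf] at h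
  exact ae_of_ae_map (f := fun (ω : ι → X) p => ω (f p))
    (Measurable.aemeasurable (by fun_prop)) h

variable {d : ℕ} {S : Finset (Fin d → ℤ)}

theorem subsingleton_stepLaw (S : Finset (Fin 0 → ℤ)) : Subsingleton (StepLaw S) := by
  refine ⟨fun p q => Subtype.ext (funext fun s => ?_)⟩
  have h1 := p.2.2
  have h2 := q.2.2
  rw [Fintype.sum_eq_single s fun t ht => absurd (Subsingleton.elim t s) ht] at h1 h2
  rw [h1, h2]

theorem exists_injective_translates (hd : 0 < d) (N : ℕ) :
    ∃ z : ℕ → Fin d → ℤ, Function.Injective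
      fun p : ℕ × box d N => z p.1 + (p.2 : Fin d → ℤ) := by
  refine ⟨fun k _ => k * (2 * N + 1), ?_⟩
  rintro ⟨k, y, hy⟩ ⟨k', y', hy'⟩ h
  have hk : k = k' := by
    have h1 := congrFun h ⟨0, hd⟩
    have h2 := mem_box.1 hy ⟨0, hd⟩
    have h3 := mem_box.1 hy' ⟨0, hd⟩
    simp only [Pi.add_apply] at h1
    rcases lt_trichotomy k k' with hlt | heq | hlt
    · have : ((k : ℤ) + 1) * (2 * N + 1) ≤ k' * (2 * N + 1) := by gcongr; exact_mod_cast hlt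
      rw [add_mul, one_mul] at this
      omega
    · exact heq
    · have : ((k' : ℤ) + 1) * (2 * N + 1) ≤ k * (2 * N + 1) := by gcongr; exact_mod_cast hlt
      rw [add_mul, one_mul] at this
      omega
  subst hk
  simpa using h

/-- A pattern of laws from the support of `Q` almost surely occurs in the environment on balls of
any radius, up to a factor `c < 1`. In dimension `0` there is only one site, but also only one
step law. -/
theorem ae_exists_pattern (Q : Measure (StepLaw S)) [IsProbabilityMeasure Q]
    {π : (Fin d → ℤ) → StepLaw S} (hπ : ∀ y, π y ∈ Q.support) {c : ℝ} (hc : c < 1) (N : ℕ) :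
    ∀ᵐ ω ∂(envLaw Q), ∃ z, ∀ y, size y ≤ N → ∀ s, c * (π y).1 s ≤ (ω (z + y)).1 s := by
  rcases Nat.eq_zero_or_pos d with rfl | hd
  · have := subsingleton_stepLaw S
    refine Eventually.of_forall fun ω => ⟨0, fun y _ s => ?_⟩
    rw [Subsingleton.elim (ω (0 + y)) (π y)]
    exact mul_le_of_le_one_left ((π y).2.1 s) hc.le
  · obtain ⟨z, hz⟩ := exists_injective_translates hd N
    have hcoord : ∀ s : S, Continuous fun q : StepLaw S => q.1 s := fun s =>
      (continuous_apply s).comp continuous_subtype_val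
    have hae := ae_exists_forall_mem Q
      (A := fun y : box d N => {q : StepLaw S | ∀ s, c * (π y).1 s ≤ q.1 s}) (fun y => ?_)
      (fun y => ?_) hz
    · filter_upwards [hae] with ω ⟨k, hk⟩
      refine ⟨z k, fun y hy s => hk ⟨y, mem_box.2 fun i => le_trans ?_ hy⟩ s⟩
      exact Finset.single_le_sum (f := fun i => (y i).natAbs) (fun _ _ => Nat.zero_le _)
        (Finset.mem_univ i)
    · rw [Set.ofPred_forall]
      exact MeasurableSet.iInter fun s =>
        (isClosed_le continuous_const (hcoord s)).measurableSet
    · refine (Measure.mem_support_iff_forall _).1 (hπ y) _ ?_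
      refine eventually_all.2 fun s => ?_
      rcases ((π y).2.1 s).eq_or_lt' with h0 | h0
      · refine Eventually.of_forall fun q => ?_
        rw [h0, mul_zero]
        exact q.2.1 s
      · have : c * (π y).1 s < (π y).1 s := mul_lt_of_lt_one_left h0 hc
        exact ((hcoord s).tendsto (π y)).eventually (eventually_ge_nhds this)

theorem ae_mem_support (Q : Measure (StepLaw S)) [IsProbabilityMeasure Q] :
    ∀ᵐ ω ∂(envLaw Q), ∀ x, ω x ∈ Q.support := by
  refine ae_all_iff.2 fun x => ?_
  have h : ∀ᵐ q ∂Q, q ∈ Q.support := Measure.support_mem_ae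
  refine ae_of_ae_map (f := fun ω : (Fin d → ℤ) → StepLaw S => ω x)
    (measurable_pi_apply x).aemeasurable ?_
  rwa [envLaw, Measure.infinitePi_map_eval]

theorem isElliptic_of_mem_support {Q : Measure (StepLaw S)} {S' : Set S} {γ : ℝ}
    (hQ : ∀ᵐ q : StepLaw S ∂Q, ∀ s ∈ S', γ < q.1 s) {q : StepLaw S} (hq : q ∈ Q.support) :
    IsElliptic S' γ q.1 := by
  refine ⟨q.2.1, q.2.2, ?_⟩
  have hclosed : IsClosed {q : StepLaw S | ∀ s ∈ S', γ ≤ q.1 s} := by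
    simp only [Set.ofPred_forall]
    exact isClosed_iInter fun s => isClosed_iInter fun _ =>
      isClosed_le continuous_const ((continuous_apply s).comp continuous_subtype_val)
  refine Measure.support_subset_of_isClosed hclosed ?_ hq
  filter_upwards [hQ] with q hq s hs using (hq s hs).le

end RWRE

/-! ### The spectral radius of the random environment -/

theorem mainTheorem5 {d : ℕ} (S : Finset (Fin d → ℤ))
    (Q : Measure (RWRE.StepLaw S)) [IsProbabilityMeasure Q]
    (S' : Set S) (hS' : AddSubmonoid.closure (Subtype.val '' S' : Set (Fin d → ℤ)) = ⊤)
    (γ : ℝ) (hγ : 0 < γ)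
    (hQ : ∀ᵐ q : RWRE.StepLaw S ∂Q, ∀ s ∈ S', γ < q.1 s) :
    ∀ᵐ ω ∂(RWRE.envLaw Q), ∀ x : Fin d → ℤ,
      IsLUB ((fun p => RWRE.spectralRadius (RWRE.homKernel p) x) '' RWRE.hullSupport Q)
        (RWRE.spectralRadius (RWRE.envKernel (fun z => (ω z).1)) x) ∧
      IsLUB ((fun p => ⨅ θ : Fin d → ℝ, RWRE.expMoment p θ) '' RWRE.hullSupport Q)
        (RWRE.spectralRadius (RWRE.envKernel (fun z => (ω z).1)) x) ∧
      (RWRE.spectralRadius (RWRE.envKernel (fun z => (ω z).1)) x = 1 ↔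
        ∃ p ∈ RWRE.hullSupport Q, RWRE.drift p = 0) := by
  set A : Set (S → ℝ) := Subtype.val '' Q.support with hAdef
  have hA : IsCompact A := Measure.isClosed_support.isCompact.image continuous_subtype_val
  have hAne : A.Nonempty :=
    (Measure.nonempty_support (IsProbabilityMeasure.ne_zero Q)).image _
  have hell : ∀ q ∈ A, RWRE.IsElliptic S' γ q := by
    rintro _ ⟨q, hq, rfl⟩
    exact RWRE.isElliptic_of_mem_support hQ hq
  have hhull : ∀ p ∈ RWRE.hullSupport Q, RWRE.IsElliptic S' γ p := fun p hp =>
    RWRE.IsElliptic.of_mem_convexHull hell hp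
  obtain ⟨θ₀, M, hM, hmin⟩ := RWRE.exists_minimax hS' hγ hA hAne hell
  obtain ⟨p₀, hp₀, hp₀M, hp₀g⟩ := RWRE.exists_mem_convexHull_grad_eq_zero hA
    (fun q hq => (hell q hq).nonneg) hM hmin
  replace hp₀ : p₀ ∈ RWRE.hullSupport Q := hp₀
  have hinf₀ : ⨅ θ, RWRE.expMoment p₀ θ = M :=
    (RWRE.iInf_expMoment_of_grad_eq_zero (hhull p₀ hp₀).nonneg hp₀g).trans hp₀M
  -- at `y` the trap uses a maximizing law whose tilted drift does not point along `y`
  have hpat : ∀ y : Fin d → ℤ, ∃ q : RWRE.StepLaw S, q ∈ Q.support ∧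
      RWRE.expMoment q.1 θ₀ = M ∧ ∑ i, (y i : ℝ) * RWRE.expMomentGrad q.1 θ₀ i ≤ 0 := by
    intro y
    obtain ⟨_, ⟨q, hq, rfl⟩, hqM, hqg⟩ := RWRE.exists_grad_nonneg hA
      (fun q hq => (hell q hq).nonneg) hM hmin fun i => -(y i : ℝ)
    simp only [neg_mul, Finset.sum_neg_distrib, Left.nonneg_neg_iff] at hqg
    exact ⟨q, hq, hqM, hqg⟩
  choose π hπ hπM hπg using hpat
  have htrap : RWRE.IsTrap θ₀ M fun y => (π y).1 :=
    ⟨fun y => (π y).2.1, hπM, hπg⟩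
  have hMhull : ∀ p ∈ RWRE.hullSupport Q, RWRE.expMoment p θ₀ ≤ M := by
    intro p hp
    exact convexHull_min (t := {p : S → ℝ | RWRE.expMoment p θ₀ ≤ M}) hM
      (convex_halfSpace_le (RWRE.isLinearMap_expMoment θ₀) M) hp
  have hLUB : IsLUB ((fun p => ⨅ θ : Fin d → ℝ, RWRE.expMoment p θ) '' RWRE.hullSupport Q) M := by
    refine IsGreatest.isLUB ⟨⟨p₀, hp₀, hinf₀⟩, ?_⟩
    rintro _ ⟨p, hp, rfl⟩
    exact (ciInf_le (RWRE.bddBelow_range_expMoment (hhull p hp).nonneg) θ₀).trans (hMhull p hp)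
  have hone : M = 1 ↔ ∃ p ∈ RWRE.hullSupport Q, RWRE.drift p = 0 := by
    constructor
    · intro hM1
      refine ⟨p₀, hp₀, RWRE.drift_eq_zero_of_forall_one_le (hhull p₀ hp₀).sum_eq_one fun θ => ?_⟩
      rw [← hM1, ← hinf₀]
      exact ciInf_le (RWRE.bddBelow_range_expMoment (hhull p₀ hp₀).nonneg) θ
    · rintro ⟨p, hp, hdrift⟩
      refine le_antisymm ?_ ?_
      · rw [← hinf₀, ← RWRE.expMoment_zero (hhull p₀ hp₀).sum_eq_one]
        exact ciInf_le (RWRE.bddBelow_range_expMoment (hhull p₀ hp₀).nonneg) 0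
      · rw [← RWRE.expMomentGrad_zero] at hdrift
        rw [← RWRE.expMoment_zero (hhull p hp).sum_eq_one]
        exact (RWRE.expMoment_le_of_grad_eq_zero (hhull p hp).nonneg hdrift θ₀).trans
          (hMhull p hp)
  have hrich : ∀ᵐ ω ∂(RWRE.envLaw Q), ∀ j N : ℕ, ∃ z, ∀ y, RWRE.size y ≤ N → ∀ s,
      (1 - 1 / ((j : ℝ) + 2)) * (π y).1 s ≤ (ω (z + y)).1 s := by
    refine ae_all_iff.2 fun j => ae_all_iff.2 fun N => RWRE.ae_exists_pattern Q hπ ?_ N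
    have : (0 : ℝ) < 1 / ((j : ℝ) + 2) := by positivity
    linarith
  filter_upwards [hrich, RWRE.ae_mem_support Q] with ω hω hωQ x
  have hωA : ∀ x, (ω x).1 ∈ A := fun x => ⟨ω x, hωQ x, rfl⟩
  have hρ : RWRE.spectralRadius (RWRE.envKernel fun z => (ω z).1) x = M :=
    htrap.spectralRadius_eq hS' hγ (fun x => hell _ (hωA x)) (fun x => hM _ (hωA x)) hω x
  rw [hρ]
  refine ⟨?_, hLUB, hone⟩
  rwa [Set.image_congr fun p hp => RWRE.spectralRadius_homKernel hS' hγ (hhull p hp) x]
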